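/- For $a\in\mathbb C$ and $k\in\mathbb N_0$ let $(a)_k=a(a+1)\cdots(a+k-1)$, and let $${}_pF_q\left(\begin{matrix}a_1,\dots,a_p\\ b_1,\dots,b_q\end{matrix}\,\Big|\,x\right)=\sum_{k=0}^\infty\frac{(a_1)_k\cdots(a_p)_k}{(b_1)_k\cdots(b_q)_k\,k!}x^k$$ whenever none of $b_1,\dots,b_q$ is a non-positive integer. Let $b,c,f\in\mathbb C$, put $s=b+c$, $p=bc$, $F=f(f+1)$, and let $$P_6(t)=A_0-A_1t+A_2t^2-A_3t^3+A_4t^4-A_5t^5+A_6t^6,$$ where $$A_0=64f^2(f+1)^2(c+\tfrac12)_2(b+\tfrac12)_2(c+b)_2,$$ $$\begin{aligned}A_1={}&p^2\big[8(4F(4f+1)-3)s^2+16(F(8f^2+16f+1)-3)s+2(32F^2-9)\big]\\&+p\big[8(2F(16f+5)-3)s^3+8s^2(2F(16f^2+52f+9)-9)+2s(2F(108f^2+188f+7)-33)\\&\qquad+2(2F(40f^2+40f-9)-9)\big]+48f(2f^2+3f+1)s^4+48F(2f^2+8f+3)s^3\\&+12F(18f^2+40f+11)s^2+12F(11f^2+17f+3)s+18F^2,\end{aligned}$$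 $$\begin{aligned}A_2={}&p^2\big[4s^2(24f^2+16f+3)+8s(2f(16f^2+27f+8)-1)+16F(4f^2+12f+1)-15\big]\\&+p\big[4s^3(32f+44f^2-1)+4s^2(128f^3+276f^2+112f-15)\\&\qquad+s(12f(12f^3+96f^2+128f+33)-107)+2f(72f^3+304f^2+279f+29)-51\big]\\&+3F\big[16s^4+16s^3(4f+5)+4s^2(6f^2+42f+29)+4s(9f^2+31f+14)+(11f^2+23f+6)\big],\end{aligned}$$ $$\begin{aligned}A_3={}&2p^2\big[4s^2(4f+1)+4s(4f+3)(6f+1)+8f(8f^2+17f+6)-1\big]\\&+2p\big[12s^3(2f+1)+8s^2(22f^2+25f+4)+s(8f(18f^2+63f+41)+11)\\&\qquad+8f^4+160f^3+326f^2+141f-10\big]\\&+96Fs^3+144s^2F(2+f)+24sF(f^2+10f+10)+3F(6f^2+28f+17),\end{aligned}$$ $$\begin{aligned}A_4={}&p^2\big(96f^2+8(8f+3)s+112f+4s^2+15\big)\\&+p\big(32f^3+(196f^2+340f+103)s+246f^2+(96f+60)s^2+258f+4s^3+43\big)\\&+3f(f^3+14f^2+30f+17)+72f(f+1)s^2+12f(f+1)(4f+11)s,\end{aligned}$$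 $$\begin{aligned}A_5={}&8p^2(s+4f+2)+p\big((52f+44)s+20f^2+74f+8s^2+38\big)\\&+24f(f+1)s+3f(2f^2+9f+7),\end{aligned}$$ $$A_6=4p^2+(4(2+f)+4s)p+3f(1+f).$$ Suppose that $P_6$ has degree $6$, let $\boldsymbol\lambda=(\lambda_1,\dots,\lambda_6)$ be its complex roots, listed with multiplicity, and suppose that none of the bottom parameters $c+b+\tfrac52,\ f,\ 2c+2b+4,\ \lambda_1,\dots,\lambda_6$ is a non-positive integer. Then $$\left[{}_3F_2\left(\begin{matrix}c,\,b,\,f+2\\ c+b+\frac52,\,f\end{matrix}\,\Big|\,x\right)\right]^2={}_9F_8\left(\begin{matrix}2c,\,2b,\,c+b,\,\lambda_1+1,\dots,\lambda_6+1\\ c+b+\frac52,\,2c+2b+4,\,\lambda_1,\dots,\lambda_6\end{matrix}\,\Big|\,x\right).$$ The identity holds between formal power series in $x$. It also holds between functions: for every complex $x$ with $|x|<1$ both series converge absolutely and the identity holds between their sums, and it holds between the sums at every other complex $x$ at which both series converge. -/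

import Mathlib

open Polynomial Filter Topology

noncomputable section

/-- Rising factorial `(a)_k = a (a+1) ⋯ (a+k-1)`. -/
def poch (a : ℂ) (k : ℕ) : ℂ := (ascPochhammer ℂ k).eval a

/-- The `k`-th coefficient `(a₁)_k ⋯ (a_p)_k / ((b₁)_k ⋯ (b_q)_k k!)` of the generalized
hypergeometric series with top parameters `as` and bottom parameters `bs`. -/
def hypCoeff (as bs : Multiset ℂ) (k : ℕ) : ℂ :=
  (as.map fun a => poch a k).prod / ((bs.map fun b => poch b k).prod * (k.factorial : ℂ))

/-- The generalized hypergeometric series as a formal power series. -/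
def hypSeries (as bs : Multiset ℂ) : PowerSeries ℂ := PowerSeries.mk (hypCoeff as bs)

/-- The `k`-th term of the generalized hypergeometric series at the point `x`. -/
def hypTerm (as bs : Multiset ℂ) (x : ℂ) (k : ℕ) : ℂ := hypCoeff as bs k * x ^ k

/-- The generalized hypergeometric function: the sum of the series at `x`. -/
def hypFun (as bs : Multiset ℂ) (x : ℂ) : ℂ := ∑' k, hypTerm as bs x k

/-- `z` is not one of `0, -1, -2, …`, i.e. it is allowed as a bottom parameter. -/
def NotNonposInt (z : ℂ) : Prop := ∀ n : ℕ, z ≠ -(n : ℂ)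

/-! Coefficients of the characteristic polynomial, as functions of `f`, `s = b + c`, `p = b c`,
with `F = f (f + 1)`, except for the first one, which is written in terms of `b`, `c`, `f`. -/

def coeffA0 (b c f : ℂ) : ℂ :=
  64 * f ^ 2 * (f + 1) ^ 2 * poch (c + 1 / 2) 2 * poch (b + 1 / 2) 2 * poch (c + b) 2

def coeffA1 (s p f : ℂ) : ℂ :=
  let F := f * (f + 1)
  p ^ 2 * (8 * (4 * F * (4 * f + 1) - 3) * s ^ 2
      + 16 * (F * (8 * f ^ 2 + 16 * f + 1) - 3) * s + 2 * (32 * F ^ 2 - 9))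
    + p * (8 * (2 * F * (16 * f + 5) - 3) * s ^ 3
      + 8 * s ^ 2 * (2 * F * (16 * f ^ 2 + 52 * f + 9) - 9)
      + 2 * s * (2 * F * (108 * f ^ 2 + 188 * f + 7) - 33)
      + 2 * (2 * F * (40 * f ^ 2 + 40 * f - 9) - 9))
    + 48 * f * (2 * f ^ 2 + 3 * f + 1) * s ^ 4
    + 48 * F * (2 * f ^ 2 + 8 * f + 3) * s ^ 3
    + 12 * F * (18 * f ^ 2 + 40 * f + 11) * s ^ 2
    + 12 * F * (11 * f ^ 2 + 17 * f + 3) * s + 18 * F ^ 2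

def coeffA2 (s p f : ℂ) : ℂ :=
  let F := f * (f + 1)
  p ^ 2 * (4 * s ^ 2 * (24 * f ^ 2 + 16 * f + 3)
      + 8 * s * (2 * f * (16 * f ^ 2 + 27 * f + 8) - 1)
      + 16 * F * (4 * f ^ 2 + 12 * f + 1) - 15)
    + p * (4 * s ^ 3 * (32 * f + 44 * f ^ 2 - 1)
      + 4 * s ^ 2 * (128 * f ^ 3 + 276 * f ^ 2 + 112 * f - 15)
      + s * (12 * f * (12 * f ^ 3 + 96 * f ^ 2 + 128 * f + 33) - 107)
      + 2 * f * (72 * f ^ 3 + 304 * f ^ 2 + 279 * f + 29) - 51)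
    + 3 * F * (16 * s ^ 4 + 16 * s ^ 3 * (4 * f + 5)
      + 4 * s ^ 2 * (6 * f ^ 2 + 42 * f + 29)
      + 4 * s * (9 * f ^ 2 + 31 * f + 14) + (11 * f ^ 2 + 23 * f + 6))

def coeffA3 (s p f : ℂ) : ℂ :=
  let F := f * (f + 1)
  2 * p ^ 2 * (4 * s ^ 2 * (4 * f + 1) + 4 * s * (4 * f + 3) * (6 * f + 1)
      + 8 * f * (8 * f ^ 2 + 17 * f + 6) - 1)
    + 2 * p * (12 * s ^ 3 * (2 * f + 1) + 8 * s ^ 2 * (22 * f ^ 2 + 25 * f + 4)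
      + s * (8 * f * (18 * f ^ 2 + 63 * f + 41) + 11)
      + 8 * f ^ 4 + 160 * f ^ 3 + 326 * f ^ 2 + 141 * f - 10)
    + 96 * F * s ^ 3 + 144 * s ^ 2 * F * (2 + f)
    + 24 * s * F * (f ^ 2 + 10 * f + 10) + 3 * F * (6 * f ^ 2 + 28 * f + 17)

def coeffA4 (s p f : ℂ) : ℂ :=
  p ^ 2 * (96 * f ^ 2 + 8 * (8 * f + 3) * s + 112 * f + 4 * s ^ 2 + 15)
    + p * (32 * f ^ 3 + (196 * f ^ 2 + 340 * f + 103) * s + 246 * f ^ 2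
      + (96 * f + 60) * s ^ 2 + 258 * f + 4 * s ^ 3 + 43)
    + 3 * f * (f ^ 3 + 14 * f ^ 2 + 30 * f + 17)
    + 72 * f * (f + 1) * s ^ 2 + 12 * f * (f + 1) * (4 * f + 11) * s

def coeffA5 (s p f : ℂ) : ℂ :=
  8 * p ^ 2 * (s + 4 * f + 2)
    + p * ((52 * f + 44) * s + 20 * f ^ 2 + 74 * f + 8 * s ^ 2 + 38)
    + 24 * f * (f + 1) * s + 3 * f * (2 * f ^ 2 + 9 * f + 7)

def coeffA6 (s p f : ℂ) : ℂ :=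
  4 * p ^ 2 + (4 * (2 + f) + 4 * s) * p + 3 * f * (1 + f)

/-- The characteristic polynomial
`P₆(t) = A₀ - A₁ t + A₂ t² - A₃ t³ + A₄ t⁴ - A₅ t⁵ + A₆ t⁶`. -/
def charPoly6 (b c f : ℂ) : ℂ[X] :=
  C (coeffA0 b c f) - C (coeffA1 (b + c) (b * c) f) * X
    + C (coeffA2 (b + c) (b * c) f) * X ^ 2 - C (coeffA3 (b + c) (b * c) f) * X ^ 3
    + C (coeffA4 (b + c) (b * c) f) * X ^ 4 - C (coeffA5 (b + c) (b * c) f) * X ^ 5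
    + C (coeffA6 (b + c) (b * c) f) * X ^ 6

/-- Top parameters `c, b, f + 2`. -/
def topL (b c f : ℂ) : Multiset ℂ := {c, b, f + 2}

/-- Bottom parameters `c + b + 5/2, f`. -/
def botL (b c f : ℂ) : Multiset ℂ := {c + b + 5 / 2, f}

/-- Top parameters `2c, 2b, c + b, λ₁ + 1, …, λ₆ + 1`. -/
def topR (b c : ℂ) (lam : Fin 6 → ℂ) : Multiset ℂ :=
  {2 * c, 2 * b, c + b} + Finset.univ.val.map fun i => lam i + 1

/-- Bottom parameters `c + b + 5/2, 2c + 2b + 4, λ₁, …, λ₆`. -/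
def botR (b c : ℂ) (lam : Fin 6 → ℂ) : Multiset ℂ :=
  {c + b + 5 / 2, 2 * c + 2 * b + 4} + Finset.univ.val.map lam

end

/-!
Let `s = b + c`, `p = b c`, and let `a_k` be the coefficients of `₂F₁(b, c; s + 5/2)`. Since
`(f + 2)_k / (f)_k = (f + k) (f + 1 + k) / (f (f + 1))`, the coefficient of `x ^ n` in the square
on the left is, up to the factor `(f (f + 1)) ^ 2`, the sum over `j + k = n` of
`a_j a_k (f + j) (f + k) (f + 1 + j) (f + 1 + k)`. On `j + k = n` this weight is a quadratic
polynomial in `j k` with coefficients depending on `n` and `f` only, so everything reduces to the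
three moments `M_i(n) = ∑ a_j a_k (j k) ^ i`, `i = 0, 1, 2`, in which `f` no longer occurs.

The point is that each moment is a polynomial in `n` times one hypergeometric term:
`K M_i(n) = w_n R_i(n)`, where `w_n` is the coefficient of
`₃F₂(2c, 2b, s; s + 5/2, 2s + 4)`, the `R_i` are explicit polynomials and `K = R_0(0)`
(`convMoment_eq`). This is proved by induction on `n`. With `g = s + 3/2`, the recurrence
`(k + 1) (k + 1 + g) a_{k+1} = (k + c) (k + b) a_k` gives, for every weight `h`,
`∑_{j+k=n+1} a_j a_k j (j + g) h(j) = ∑_{j+k=n} a_j a_k (j + c) (j + b) h(j + 1)`.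
For `h = 1, t, t²`, after symmetrizing in `j` and `k`, these are three linear equations for the
moments at `n + 1` in terms of those at `n`; their determinant is a multiple of
`(n + 1) (n + 1 + g) (n + 1 + 2 g)`, which is the denominator of `w_{n+1} / w_n` and does not
vanish because `s + 5/2` and `2s + 4` are admissible bottom parameters (`moment_step`).

Recombining the three moments with the weight gives exactly the characteristic polynomial at `-n`
(`eval_charPoly6_neg`), whose quotient by its constant coefficient is `∏ (λ_i + n) / λ_i`. As the
`λ_i` do not vanish, neither does the constant coefficient `A₀ = (f (f + 1)) ^ 2 K`; in
particular `K ≠ 0`.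

The identity between functions follows from that between coefficients by absolute convergence in
the unit disc and, at the other points of convergence, from Abel's theorem along the radius.
-/

/-! ### Hypergeometric coefficients -/

lemma poch_zero (a : ℂ) : poch a 0 = 1 := by simp [poch]

lemma poch_succ (a : ℂ) (k : ℕ) : poch a (k + 1) = poch a k * (a + k) := by
  simp [poch, ascPochhammer_succ_eval]

lemma poch_ne_zero {a : ℂ} (ha : NotNonposInt a) (k : ℕ) : poch a k ≠ 0 := by
  induction k with
  | zero => simp [poch_zero]
  | succ k ih =>
    rw [poch_succ]
    exact mul_ne_zero ih fun h => ha k (eq_neg_of_add_eq_zero_left h)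

lemma NotNonposInt.ne_zero {a : ℂ} (ha : NotNonposInt a) : a ≠ 0 := by
  simpa using ha 0

lemma NotNonposInt.add_natCast_ne_zero {a : ℂ} (ha : NotNonposInt a) (k : ℕ) : a + k ≠ 0 :=
  fun h => ha k (eq_neg_of_add_eq_zero_left h)

lemma poch_add_one_mul (a : ℂ) (k : ℕ) : poch (a + 1) k * a = poch a k * (a + k) := by
  induction k with
  | zero => simp [poch_zero]
  | succ k ih =>
    rw [poch_succ, poch_succ]
    push_cast
    linear_combination (a + 1 + k) * ih

lemma poch_add_one_div {a : ℂ} (ha : NotNonposInt a) (k : ℕ) :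
    poch (a + 1) k / poch a k = (a + k) / a := by
  rw [div_eq_div_iff (poch_ne_zero ha k) ha.ne_zero, poch_add_one_mul, mul_comm]

lemma hypCoeff_zero (as bs : Multiset ℂ) : hypCoeff as bs 0 = 1 := by
  simp [hypCoeff, poch_zero]

lemma hypCoeff_succ (as bs : Multiset ℂ) (k : ℕ) :
    hypCoeff as bs (k + 1) = hypCoeff as bs k *
      ((as.map fun a => a + (k : ℂ)).prod /
        ((bs.map fun b => b + (k : ℂ)).prod * ((k : ℂ) + 1))) := by
  simp only [hypCoeff, poch_succ, Multiset.prod_map_mul, Nat.factorial_succ]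
  push_cast
  rw [div_mul_div_comm]
  congr 1
  ring

/-- Pairs of parameters `l + 1` on top and `l` at the bottom multiply the `k`-th coefficient by a
polynomial in `k`. -/
lemma hypCoeff_add_map_add_one (as bs ls : Multiset ℂ) (hls : ∀ l ∈ ls, NotNonposInt l) (k : ℕ) :
    hypCoeff (as + ls.map fun l => l + 1) (bs + ls) k =
      hypCoeff as bs k * (ls.map fun l => (l + (k : ℂ)) / l).prod := by
  have h : (ls.map fun l => (l + (k : ℂ)) / l).prod =
      (ls.map fun l => poch (l + 1) k).prod / (ls.map fun l => poch l k).prod := by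
    rw [← Multiset.prod_map_div]
    exact congrArg _ (Multiset.map_congr rfl fun l hl => (poch_add_one_div (hls l hl) k).symm)
  rw [h]
  simp only [hypCoeff, Multiset.map_add, Multiset.map_map, Multiset.prod_add, Function.comp_def]
  rw [div_mul_div_comm]
  congr 1
  ring

/-! ### Convergence -/

lemma tendsto_natCast_add_div_add_one (a : ℂ) :
    Tendsto (fun k : ℕ => (a + k) / ((k : ℂ) + 1)) atTop (𝓝 1) := by
  have h : Tendsto (fun k : ℕ => 1 + (a - 1) * (1 / ((k : ℂ) + 1))) atTop (𝓝 (1 + (a - 1) * 0)) :=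
    (tendsto_one_div_add_atTop_nhds_zero_nat (𝕜 := ℂ)).const_mul _ |>.const_add _
  simp only [mul_zero, add_zero] at h
  refine h.congr fun k => ?_
  have : (k : ℂ) + 1 ≠ 0 := Nat.cast_add_one_ne_zero k
  field_simp
  ring

lemma tendsto_prod_add_div_add_one_pow (as : Multiset ℂ) :
    Tendsto (fun k : ℕ => (as.map fun a => a + (k : ℂ)).prod / ((k : ℂ) + 1) ^ as.card)
      atTop (𝓝 1) := by
  have h := tendsto_multiset_prod (f := fun (a : ℂ) (k : ℕ) => (a + k) / ((k : ℂ) + 1))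
    (a := fun _ => 1) as (x := atTop) fun a _ => tendsto_natCast_add_div_add_one a
  simpa [Multiset.prod_map_div] using h

/-- With one more parameter on top than at the bottom, the series converges absolutely in the
unit disc: the quotients of consecutive coefficients tend to `1`. -/
lemma summable_hypTerm {as bs : Multiset ℂ} (hcard : as.card = bs.card + 1) {x : ℂ}
    (hx : ‖x‖ < 1) : Summable fun k => ‖hypTerm as bs x k‖ := by
  have h := (((tendsto_prod_add_div_add_one_pow as).div
    (tendsto_prod_add_div_add_one_pow bs) one_ne_zero).mul_const x).norm
  have hev := h.eventually_le_const (u := (1 + ‖x‖) / 2)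
    (by rw [div_one, one_mul]; linarith)
  refine summable_of_ratio_norm_eventually_le (r := (1 + ‖x‖) / 2) (by linarith) ?_
  filter_upwards [hev] with k hk
  rw [norm_norm, norm_norm]
  have hk0 : (k : ℂ) + 1 ≠ 0 := Nat.cast_add_one_ne_zero k
  have key : hypTerm as bs x (k + 1) =
      ((as.map fun a => a + (k : ℂ)).prod / ((k : ℂ) + 1) ^ as.card /
        ((bs.map fun a => a + (k : ℂ)).prod / ((k : ℂ) + 1) ^ bs.card) * x) *
        hypTerm as bs x k := by
    have hcancel (A B : ℂ) : A / ((k : ℂ) + 1) ^ (bs.card + 1) / (B / ((k : ℂ) + 1) ^ bs.card) =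
        A / (B * ((k : ℂ) + 1)) := by
      rw [div_div_div_eq, pow_succ, mul_comm (_ * _) B, mul_left_comm, mul_comm A,
        mul_div_mul_left _ _ (pow_ne_zero _ hk0)]
    rw [hypTerm, hypTerm, hypCoeff_succ, hcard, hcancel]
    ring
  rw [key, norm_mul]
  exact mul_le_mul_of_nonneg_right hk (norm_nonneg _)

/-- The sum of a power series whose coefficients are the Cauchy square of those of an absolutely
convergent one. -/
lemma sq_tsum_eq_tsum_of_coeff {u v : ℕ → ℂ} {x : ℂ}
    (huv : ∀ n, ∑ ij ∈ Finset.HasAntidiagonal.antidiagonal n, u ij.1 * u ij.2 = v n)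
    (hs : Summable fun k => ‖u k * x ^ k‖) :
    (∑' k, u k * x ^ k) ^ 2 = ∑' k, v k * x ^ k := by
  rw [sq, tsum_mul_tsum_eq_tsum_sum_antidiagonal_of_summable_norm hs hs]
  refine tsum_congr fun n => ?_
  rw [← huv, Finset.sum_mul]
  refine Finset.sum_congr rfl fun ij hij => ?_
  rw [← Finset.HasAntidiagonal.mem_antidiagonal.mp hij, pow_add]
  ring

/-- Abel's theorem carries the Cauchy square to every point at which the two series converge,
conditionally or not. -/
lemma sq_eq_of_tendsto_of_coeff {u v : ℕ → ℂ} {x U V : ℂ}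
    (huv : ∀ n, ∑ ij ∈ Finset.HasAntidiagonal.antidiagonal n, u ij.1 * u ij.2 = v n)
    (hu : Tendsto (fun n => ∑ k ∈ Finset.range n, u k * x ^ k) atTop (𝓝 U))
    (hv : Tendsto (fun n => ∑ k ∈ Finset.range n, v k * x ^ k) atTop (𝓝 V)) :
    U ^ 2 = V := by
  have hu' := tendsto_map'_iff.mp (Complex.tendsto_tsum_powerSeries_nhdsWithin_lt hu)
  have hv' := tendsto_map'_iff.mp (Complex.tendsto_tsum_powerSeries_nhdsWithin_lt hv)
  have hzero : Tendsto (fun k => u k * x ^ k) atTop (𝓝 0) := by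
    have h := ((tendsto_add_atTop_iff_nat 1).mpr hu).sub hu
    simpa [Finset.sum_range_succ] using h
  obtain ⟨B, hB⟩ := hzero.norm.bddAbove_range
  have hcongr : (fun r : ℝ => (∑' k, u k * x ^ k * (r : ℂ) ^ k) ^ 2) =ᶠ[𝓝[<] 1]
      fun r : ℝ => ∑' k, v k * x ^ k * (r : ℂ) ^ k := by
    -- The terms of a convergent series are bounded, so the series at `r x` is dominated by a
    -- geometric one.
    filter_upwards [Ioo_mem_nhdsLT (zero_lt_one' ℝ)] with r hr
    have hs : Summable fun k => ‖u k * x ^ k * (r : ℂ) ^ k‖ := by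
      refine Summable.of_nonneg_of_le (fun _ => norm_nonneg _) (fun k => ?_)
        ((summable_geometric_of_lt_one hr.1.le hr.2).mul_left B)
      rw [norm_mul, norm_pow, Complex.norm_of_nonneg hr.1.le]
      exact mul_le_mul_of_nonneg_right (hB ⟨k, rfl⟩) (pow_nonneg hr.1.le k)
    simp only [mul_assoc, ← mul_pow] at hs ⊢
    exact sq_tsum_eq_tsum_of_coeff huv hs
  exact tendsto_nhds_unique ((hu'.pow 2).congr' hcongr) hv'

/-! ### Convolution moments -/

/-- The `i`-th convolution moment `∑ a_j a_k (j k) ^ i` of a sequence, over `j + k = n`. -/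
def convMoment (a : ℕ → ℂ) (i n : ℕ) : ℂ :=
  ∑ jk ∈ Finset.HasAntidiagonal.antidiagonal n, a jk.1 * a jk.2 * ((jk.1 : ℂ) * jk.2) ^ i

/-- By the symmetry `j ↔ k`, a polynomial weight of low degree only contributes through its
symmetrization, a quadratic polynomial in `j k`. -/
lemma two_mul_sum_antidiagonal_eq_convMoment (a : ℕ → ℂ) (n : ℕ) (φ : ℂ → ℂ) (α β γ : ℂ)
    (h : ∀ j k : ℂ, j + k = n → φ j + φ k = α + β * (j * k) + γ * (j * k) ^ 2) :
    2 * ∑ jk ∈ Finset.HasAntidiagonal.antidiagonal n, a jk.1 * a jk.2 * φ jk.1 =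
      α * convMoment a 0 n + β * convMoment a 1 n + γ * convMoment a 2 n := by
  have hswap : ∑ jk ∈ Finset.HasAntidiagonal.antidiagonal n, a jk.1 * a jk.2 * φ jk.1 =
      ∑ jk ∈ Finset.HasAntidiagonal.antidiagonal n, a jk.2 * a jk.1 * φ jk.2 :=
    (Finset.Nat.sum_antidiagonal_swap (f := fun jk : ℕ × ℕ => a jk.1 * a jk.2 * φ jk.1)).symm
  rw [two_mul]
  nth_rewrite 2 [hswap]
  simp only [convMoment, Finset.mul_sum, ← Finset.sum_add_distrib]
  refine Finset.sum_congr rfl fun jk hjk => ?_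
  have := h jk.1 jk.2 (by exact_mod_cast Finset.HasAntidiagonal.mem_antidiagonal.mp hjk)
  linear_combination a jk.1 * a jk.2 * this

/-- A two-term recurrence for `a` turns a weight on the convolution of index `n + 1` into one on
the convolution of index `n`. -/
lemma sum_antidiagonal_succ_of_recurrence {a : ℕ → ℂ} {b c g : ℂ}
    (ha : ∀ k : ℕ, ((k : ℂ) + 1) * (k + 1 + g) * a (k + 1) = (k + c) * (k + b) * a k)
    (h : ℂ → ℂ) (n : ℕ) :
    ∑ jk ∈ Finset.HasAntidiagonal.antidiagonal (n + 1),
        a jk.1 * a jk.2 * ((jk.1 : ℂ) * (jk.1 + g) * h jk.1) =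
      ∑ jk ∈ Finset.HasAntidiagonal.antidiagonal n,
        a jk.1 * a jk.2 * (((jk.1 : ℂ) + c) * (jk.1 + b) * h (jk.1 + 1)) := by
  rw [Finset.Nat.sum_antidiagonal_succ]
  simp only [Nat.cast_zero, zero_mul, mul_zero, zero_add, Nat.cast_add, Nat.cast_one]
  refine Finset.sum_congr rfl fun jk _ => ?_
  linear_combination a jk.2 * h (jk.1 + 1) * ha jk.1

/-- The polynomial `R_0(n)` attached to the moment `∑ a_j a_k` of the coefficients of
`₂F₁(b, c; s + 5/2)`, with `s = b + c` and `p = b c`. Together with `momentPoly1` and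
`momentPoly2` it is read off from the characteristic polynomial at `-n` by expanding the latter
in `f`. -/
noncomputable def momentPoly0 (s p n : ℂ) : ℂ :=
  3 * n ^ 4 + (16 * p + 24 * s + 18) * n ^ 3
    + (64 * p ^ 2 + 144 * s * p + 72 * s ^ 2 + 144 * p + 108 * s + 33) * n ^ 2
    + (128 * s * p ^ 2 + 256 * s ^ 2 * p + 96 * s ^ 3 + 64 * p ^ 2 + 432 * s * p + 216 * s ^ 2
      + 160 * p + 132 * s + 18) * n
    + 4 * s * (s + 1) * (4 * p + 2 * s + 1) * (4 * p + 6 * s + 9)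

/-- The polynomial `R_1(n)` attached to the moment `∑ a_j a_k j k`. -/
noncomputable def momentPoly1 (s p n : ℂ) : ℂ :=
  2 * p * n * (n - 1) * (n + s + 3 / 2) *
    (n ^ 2 + (8 * p + 12 * s + 13) * n + 8 * s * p + 12 * s ^ 2 + 18 * s + 6)

/-- The polynomial `R_2(n)` attached to the moment `∑ a_j a_k (j k) ^ 2`. -/
noncomputable def momentPoly2 (s p n : ℂ) : ℂ :=
  2 * p * n * (n - 1) * (n + s + 3 / 2) *
    ((2 * p + 2 * s + 3) * n ^ 3 + (2 * s * p + 2 * s ^ 2 - p + 5 * s + 3) * n ^ 2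
      + (2 * s ^ 2 - 2 * s * p - p + 3 * s) * n + 4 * s * p + 6 * p)

/-- One step of the recursion for the moments. Here `x, y, z` are the moments at `n` and
`x', y', z'` those at `n + 1`. The equations `e0`, `e1` determine `x'` and `y'`, and then `e2`
determines `z'`; up to a constant the determinant is `(n + 1) (n + 1 + g) (n + 1 + 2 g)` where
`g = s + 3 / 2`; this is the denominator of the quotient `w' / w`. -/
lemma moment_step {s p n w w' κ x y z x' y' z' : ℂ}
    (hD : (n + 1) * (n + s + 5 / 2) * (n + 2 * s + 4) ≠ 0)
    (hw : w' * ((n + 1) * (n + s + 5 / 2) * (n + 2 * s + 4)) =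
      w * ((n ^ 2 + 2 * s * n + 4 * p) * (n + s)))
    (hx : κ * x = w * momentPoly0 s p n) (hy : κ * y = w * momentPoly1 s p n)
    (hz : κ * z = w * momentPoly2 s p n)
    (e0 : (n + 1) * (n + s + 5 / 2) * x' - 2 * y' = (n ^ 2 + s * n + 2 * p) * x - 2 * y)
    (e1 : (n + 1) ^ 2 * (n + s + 5 / 2) * x' - (3 * n + 2 * s + 6) * y' =
      (n ^ 3 + (s + 1) * n ^ 2 + (s + p) * n + 2 * p) * x - (3 * n + 2 * s + 2) * y)
    (e2 : (n + 1) ^ 3 * (n + s + 5 / 2) * x'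
        - (4 * (n + 1) ^ 2 + 3 * (s + 3 / 2) * (n + 1)) * y' + 2 * z' =
      (n ^ 4 + (s + 2) * n ^ 3 + (2 * s + p + 1) * n ^ 2 + (s + 2 * p) * n + 2 * p) * x
        - (4 * n ^ 2 + 3 * (s + 2) * n + 2 * (2 * s + p + 1)) * y + 2 * z) :
    κ * x' = w' * momentPoly0 s p (n + 1) ∧ κ * y' = w' * momentPoly1 s p (n + 1) ∧
      κ * z' = w' * momentPoly2 s p (n + 1) := by
  -- Each unknown is isolated by Cramer's rule; `hw` then trades `w'` for `w`.
  have hx' : κ * x' = w' * momentPoly0 s p (n + 1) := by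
    refine mul_left_cancel₀ hD ?_
    linear_combination (norm := (unfold momentPoly0 momentPoly1; ring1))
      κ * ((3 * n + 2 * s + 6) * e0 - 2 * e1)
      + ((3 * n + 2 * s + 6) * (n ^ 2 + s * n + 2 * p)
        - 2 * (n ^ 3 + (s + 1) * n ^ 2 + (s + p) * n + 2 * p)) * hx - 8 * hy
      - momentPoly0 s p (n + 1) * hw
  have hy' : κ * y' = w' * momentPoly1 s p (n + 1) := by
    refine mul_left_cancel₀ hD ?_
    linear_combination (norm := (unfold momentPoly0 momentPoly1; ring1))
      κ * (n + 1) * (n + s + 5 / 2) * ((n + 1) * e0 - e1)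
      + (n + 1) * (n + s + 5 / 2) * (((n + 1) * (n ^ 2 + s * n + 2 * p)
        - (n ^ 3 + (s + 1) * n ^ 2 + (s + p) * n + 2 * p)) * hx
        + (-2 * (n + 1) + (3 * n + 2 * s + 2)) * hy)
      - momentPoly1 s p (n + 1) * hw
  refine ⟨hx', hy', mul_left_cancel₀ hD ?_⟩
  linear_combination (norm := (unfold momentPoly0 momentPoly1 momentPoly2; ring1))
    (n + 1) * (n + s + 5 / 2) * (n + 2 * s + 4) * (κ / 2 * e2
      - (n + 1) ^ 3 * (n + s + 5 / 2) / 2 * hx'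
      + (4 * (n + 1) ^ 2 + 3 * (s + 3 / 2) * (n + 1)) / 2 * hy'
      + (n ^ 4 + (s + 2) * n ^ 3 + (2 * s + p + 1) * n ^ 2 + (s + 2 * p) * n + 2 * p) / 2 * hx
      - (4 * n ^ 2 + 3 * (s + 2) * n + 2 * (2 * s + p + 1)) / 2 * hy + hz)
    - ((n + 1) ^ 3 * (n + s + 5 / 2) / 2 * momentPoly0 s p (n + 1)
      - (4 * (n + 1) ^ 2 + 3 * (s + 3 / 2) * (n + 1)) / 2 * momentPoly1 s p (n + 1)
      + momentPoly2 s p (n + 1)) * hw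

/-- All three moments of the coefficients of `₂F₁(b, c; b + c + 5/2)` are polynomial multiples of
one hypergeometric term. -/
lemma convMoment_eq {a w : ℕ → ℂ} {b c : ℂ} (ha0 : a 0 = 1) (hw0 : w 0 = 1)
    (hs : NotNonposInt (c + b + 5 / 2)) (hs' : NotNonposInt (2 * c + 2 * b + 4))
    (ha : ∀ k : ℕ, ((k : ℂ) + 1) * (k + 1 + (c + b + 3 / 2)) * a (k + 1) =
      (k + c) * (k + b) * a k)
    (hw : ∀ k : ℕ, ((k : ℂ) + 1) * (c + b + 5 / 2 + k) * (2 * c + 2 * b + 4 + k) * w (k + 1) =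
      (2 * c + k) * (2 * b + k) * (c + b + k) * w k) (n : ℕ) :
    momentPoly0 (b + c) (b * c) 0 * convMoment a 0 n = w n * momentPoly0 (b + c) (b * c) n ∧
    momentPoly0 (b + c) (b * c) 0 * convMoment a 1 n = w n * momentPoly1 (b + c) (b * c) n ∧
    momentPoly0 (b + c) (b * c) 0 * convMoment a 2 n = w n * momentPoly2 (b + c) (b * c) n := by
  induction n with
  | zero => simp [convMoment, ha0, hw0, momentPoly1, momentPoly2]
  | succ n ih =>
    obtain ⟨hx, hy, hz⟩ := ih
    have hD : ((n : ℂ) + 1) * (n + (b + c) + 5 / 2) * (n + 2 * (b + c) + 4) ≠ 0 := by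
      refine mul_ne_zero (mul_ne_zero (Nat.cast_add_one_ne_zero n) ?_) ?_
      · convert hs.add_natCast_ne_zero n using 1; ring
      · convert hs'.add_natCast_ne_zero n using 1; ring
    -- The recurrence of `a` with weight `h`, both sides symmetrized and written in the moments.
    have rel (h : ℂ → ℂ) (α β γ α' β' γ' : ℂ)
        (H : ∀ j k : ℂ, j + k = (n + 1 : ℕ) →
          j * (j + (c + b + 3 / 2)) * h j + k * (k + (c + b + 3 / 2)) * h k =
            α + β * (j * k) + γ * (j * k) ^ 2)
        (H' : ∀ j k : ℂ, j + k = n →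
          (j + c) * (j + b) * h (j + 1) + (k + c) * (k + b) * h (k + 1) =
            α' + β' * (j * k) + γ' * (j * k) ^ 2) :
        α * convMoment a 0 (n + 1) + β * convMoment a 1 (n + 1) + γ * convMoment a 2 (n + 1) =
          α' * convMoment a 0 n + β' * convMoment a 1 n + γ' * convMoment a 2 n := by
      rw [← two_mul_sum_antidiagonal_eq_convMoment a (n + 1)
          (fun t => t * (t + (c + b + 3 / 2)) * h t) α β γ H,
        ← two_mul_sum_antidiagonal_eq_convMoment a n
          (fun t => (t + c) * (t + b) * h (t + 1)) α' β' γ' H',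
        sum_antidiagonal_succ_of_recurrence ha h n]
    have e0 := rel (fun _ => 1) (((n : ℂ) + 1) * (n + (b + c) + 5 / 2)) (-2) 0
      (n ^ 2 + (b + c) * n + 2 * (b * c)) (-2) 0
      (fun j k hjk => by
        push_cast at hjk; rw [← eq_sub_iff_add_eq'] at hjk; subst hjk; ring)
      (fun j k hjk => by rw [← hjk]; ring)
    have e1 := rel (fun t => t) (((n : ℂ) + 1) ^ 2 * (n + (b + c) + 5 / 2))
      (-(3 * n + 2 * (b + c) + 6)) 0
      (n ^ 3 + (b + c + 1) * n ^ 2 + (b + c + b * c) * n + 2 * (b * c))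
      (-(3 * n + 2 * (b + c) + 2)) 0
      (fun j k hjk => by
        push_cast at hjk; rw [← eq_sub_iff_add_eq'] at hjk; subst hjk; ring)
      (fun j k hjk => by rw [← hjk]; ring)
    have e2 := rel (fun t => t ^ 2) (((n : ℂ) + 1) ^ 3 * (n + (b + c) + 5 / 2))
      (-(4 * (n + 1) ^ 2 + 3 * (b + c + 3 / 2) * (n + 1))) 2
      (n ^ 4 + (b + c + 2) * n ^ 3 + (2 * (b + c) + b * c + 1) * n ^ 2
        + (b + c + 2 * (b * c)) * n + 2 * (b * c))
      (-(4 * n ^ 2 + 3 * (b + c + 2) * n + 2 * (2 * (b + c) + b * c + 1))) 2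
      (fun j k hjk => by
        push_cast at hjk; rw [← eq_sub_iff_add_eq'] at hjk; subst hjk; ring)
      (fun j k hjk => by rw [← hjk]; ring)
    push_cast
    exact moment_step hD (by linear_combination hw n) hx hy hz (by linear_combination e0)
      (by linear_combination e1) (by linear_combination e2)

/-! ### The characteristic polynomial -/

lemma coeffA0_eq_mul_momentPoly0 (b c f : ℂ) :
    coeffA0 b c f = (f * (f + 1)) ^ 2 * momentPoly0 (b + c) (b * c) 0 := by
  simp only [coeffA0, momentPoly0, show (2 : ℕ) = 0 + 1 + 1 from rfl, poch_succ, poch_zero]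
  push_cast
  ring

/-- The characteristic polynomial is the polynomial attached to the convolution with weight
`(f + j) (f + 1 + j) (f + k) (f + 1 + k)`, expanded in powers of `j k`. -/
lemma eval_charPoly6_neg (b c f n : ℂ) :
    (charPoly6 b c f).eval (-n) =
      f * (f + n) * ((f + 1) * (f + 1 + n)) * momentPoly0 (b + c) (b * c) n
        + (f * (f + n) + (f + 1) * (f + 1 + n)) * momentPoly1 (b + c) (b * c) n
        + momentPoly2 (b + c) (b * c) n := by
  simp only [charPoly6, eval_add, eval_sub, eval_mul, eval_C, eval_X, eval_pow,
    coeffA0_eq_mul_momentPoly0, coeffA1, coeffA2, coeffA3, coeffA4, coeffA5, coeffA6,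
    momentPoly0, momentPoly1, momentPoly2]
  ring

lemma natDegree_charPoly6_le (b c f : ℂ) : (charPoly6 b c f).natDegree ≤ 6 := by
  unfold charPoly6
  compute_degree

/-- When the roots are six nonzero numbers, the value at `-n` is recovered from the roots and the
constant coefficient. -/
lemma eval_charPoly6_neg_eq_prod_roots {b c f : ℂ} (hcard : (charPoly6 b c f).roots.card = 6)
    (h0 : ∀ l ∈ (charPoly6 b c f).roots, l ≠ 0) (n : ℂ) :
    (charPoly6 b c f).eval (-n) =
      coeffA0 b c f * ((charPoly6 b c f).roots.map fun l => (l + n) / l).prod ∧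
    coeffA0 b c f ≠ 0 := by
  set P := charPoly6 b c f with hP
  have hdeg : P.roots.card = P.natDegree :=
    le_antisymm (card_roots' P) (hcard ▸ natDegree_charPoly6_le b c f)
  have hne : P ≠ 0 := by
    rintro h
    simp [h] at hcard
  have heval (m : ℂ) : P.eval (-m) = P.leadingCoeff * (P.roots.map fun l => l + m).prod := by
    conv_lhs => rw [← C_leadingCoeff_mul_prod_multiset_X_sub_C hdeg]
    rw [eval_mul, eval_C, eval_multiset_prod, Multiset.map_map]
    have : (P.roots.map fun l => l + m) =
        P.roots.map (Neg.neg ∘ (eval (-m) ∘ fun a => X - C a)) := by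
      refine Multiset.map_congr rfl fun l _ => ?_
      simp [add_comm]
    rw [this, ← Multiset.map_map Neg.neg, Multiset.prod_map_neg, Multiset.card_map, hcard]
    norm_num
  have hA0 : coeffA0 b c f = P.leadingCoeff * P.roots.prod := by
    have := heval 0
    simpa [hP, charPoly6] using this
  have hprod : P.roots.prod ≠ 0 := Multiset.prod_ne_zero fun h => h0 0 h rfl
  refine ⟨?_, hA0 ▸ mul_ne_zero (leadingCoeff_ne_zero.mpr hne) hprod⟩
  rw [heval, hA0, Multiset.prod_map_div, Multiset.map_id']
  field_simp

/-! ### The identity of the coefficients -/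

lemma hypCoeff_topL {b c f : ℂ} (hf : NotNonposInt f) (k : ℕ) :
    hypCoeff (topL b c f) (botL b c f) k =
      hypCoeff {c, b} {c + b + 5 / 2} k * ((f + k) * (f + 1 + k) / (f * (f + 1))) := by
  have hf1 : NotNonposInt (f + 1) := fun n h => hf (n + 1) (by push_cast; linear_combination h)
  -- Read `f + 2, f` as `f + 1, f + 2` over `f, f + 1`, with the common `f + 1` cancelled.
  have h := hypCoeff_add_map_add_one {c, b} {c + b + 5 / 2} {f, f + 1}
    (by simp [hf, hf1]) k
  have hpoch := poch_ne_zero hf1 k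
  simp only [Multiset.insert_eq_cons, Multiset.map_cons, Multiset.map_singleton,
    Multiset.prod_cons, Multiset.prod_singleton, div_mul_div_comm] at h
  simp only [Multiset.insert_eq_cons]
  rw [← h]
  simp only [topL, botL, hypCoeff, Multiset.insert_eq_cons, Multiset.map_cons,
    Multiset.map_singleton, Multiset.prod_cons, Multiset.prod_singleton, Multiset.map_add,
    Multiset.prod_add, add_assoc f, one_add_one_eq_two] at hpoch ⊢
  rw [← mul_div_mul_right _ _ hpoch]
  congr 1 <;> ring

/-- The Cauchy square of the coefficients on the left is the sequence of coefficients on the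
right. -/
lemma sum_antidiagonal_hypCoeff {b c f : ℂ} {lam : Fin 6 → ℂ}
    (hlam : (charPoly6 b c f).roots = Finset.univ.val.map lam)
    (hL : ∀ z ∈ botL b c f, NotNonposInt z)
    (hR : ∀ z ∈ botR b c lam, NotNonposInt z) (n : ℕ) :
    ∑ jk ∈ Finset.HasAntidiagonal.antidiagonal n, hypCoeff (topL b c f) (botL b c f) jk.1 *
        hypCoeff (topL b c f) (botL b c f) jk.2 =
      hypCoeff (topR b c lam) (botR b c lam) n := by
  have hf : NotNonposInt f := hL f (by simp [botL])
  have hs : NotNonposInt (c + b + 5 / 2) := hL _ (by simp [botL])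
  have hs' : NotNonposInt (2 * c + 2 * b + 4) := hR _ (by simp [botR])
  have hroots : ∀ l ∈ (charPoly6 b c f).roots, NotNonposInt l := fun l hl =>
    hR l (Multiset.mem_add.mpr (.inr (hlam ▸ hl)))
  obtain ⟨hP, hA0⟩ := eval_charPoly6_neg_eq_prod_roots (b := b) (c := c) (f := f)
    (by simp [hlam]) (fun l hl => (hroots l hl).ne_zero) n
  set a := hypCoeff {c, b} {c + b + 5 / 2} with ha
  set w := hypCoeff {2 * c, 2 * b, c + b} {c + b + 5 / 2, 2 * c + 2 * b + 4} with hw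
  have hRn : hypCoeff (topR b c lam) (botR b c lam) n =
      w n * ((charPoly6 b c f).roots.map fun l => (l + (n : ℂ)) / l).prod := by
    rw [hw, ← hypCoeff_add_map_add_one _ _ _ hroots, hlam, Multiset.map_map]
    rfl
  have hrec (k : ℕ) : ((k : ℂ) + 1) * (k + 1 + (c + b + 3 / 2)) * a (k + 1) =
      (k + c) * (k + b) * a k := by
    have h1 : (k : ℂ) + 1 ≠ 0 := Nat.cast_add_one_ne_zero k
    have h2 := hs.add_natCast_ne_zero k
    rw [ha, hypCoeff_succ]
    simp only [Multiset.insert_eq_cons, Multiset.map_cons, Multiset.map_singleton,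
      Multiset.prod_cons, Multiset.prod_singleton]
    rw [show (k : ℂ) + 1 + (c + b + 3 / 2) = c + b + 5 / 2 + k by ring]
    generalize c + b + 5 / 2 + (k : ℂ) = d at *
    field_simp
    ring
  have hrec' (k : ℕ) :
      ((k : ℂ) + 1) * (c + b + 5 / 2 + k) * (2 * c + 2 * b + 4 + k) * w (k + 1) =
      (2 * c + k) * (2 * b + k) * (c + b + k) * w k := by
    have h1 : (k : ℂ) + 1 ≠ 0 := Nat.cast_add_one_ne_zero k
    have h2 := hs.add_natCast_ne_zero k
    have h3 := hs'.add_natCast_ne_zero k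
    rw [hw, hypCoeff_succ]
    simp only [Multiset.insert_eq_cons, Multiset.map_cons, Multiset.map_singleton,
      Multiset.prod_cons, Multiset.prod_singleton]
    generalize c + b + 5 / 2 + (k : ℂ) = d at *
    generalize 2 * c + 2 * b + 4 + (k : ℂ) = e at *
    field_simp
  obtain ⟨m0, m1, m2⟩ := convMoment_eq (hypCoeff_zero _ _) (hypCoeff_zero _ _) hs hs' hrec hrec' n
  have hA0' := coeffA0_eq_mul_momentPoly0 b c f
  have hF : f * (f + 1) ≠ 0 := fun h => hA0 (by rw [hA0', h]; ring)
  have hsum : (f * (f + 1)) ^ 2 * ∑ jk ∈ Finset.HasAntidiagonal.antidiagonal n,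
      hypCoeff (topL b c f) (botL b c f) jk.1 * hypCoeff (topL b c f) (botL b c f) jk.2 =
      f * (f + n) * ((f + 1) * (f + 1 + n)) * convMoment a 0 n
        + (f * (f + n) + (f + 1) * (f + 1 + n)) * convMoment a 1 n + convMoment a 2 n := by
    simp only [convMoment, Finset.mul_sum, ← Finset.sum_add_distrib]
    refine Finset.sum_congr rfl fun jk hjk => ?_
    rw [hypCoeff_topL hf, hypCoeff_topL hf, ← Finset.HasAntidiagonal.mem_antidiagonal.mp hjk]
    push_cast
    have hcancel (y z Y Z : ℂ) : (f * (f + 1)) ^ 2 *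
        (y * (Y / (f * (f + 1))) * (z * (Z / (f * (f + 1))))) = y * z * (Y * Z) := by
      generalize f * (f + 1) = F at hF
      field_simp
    rw [hcancel]
    ring
  rw [hRn]
  refine mul_left_cancel₀ hA0 ?_
  rw [mul_left_comm, ← hP, eval_charPoly6_neg, hA0', mul_right_comm, hsum]
  linear_combination f * (f + n) * ((f + 1) * (f + 1 + n)) * m0
    + (f * (f + n) + (f + 1) * (f + 1 + n)) * m1 + m2

theorem mainTheorem4 (b c f : ℂ) (lam : Fin 6 → ℂ)
    (hlam : (charPoly6 b c f).roots = Finset.univ.val.map lam)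
    (hL : ∀ z ∈ botL b c f, NotNonposInt z)
    (hR : ∀ z ∈ botR b c lam, NotNonposInt z) :
    hypSeries (topL b c f) (botL b c f) ^ 2 = hypSeries (topR b c lam) (botR b c lam) ∧
    (∀ x : ℂ, ‖x‖ < 1 →
      Summable (hypTerm (topL b c f) (botL b c f) x) ∧
      Summable (hypTerm (topR b c lam) (botR b c lam) x) ∧
      hypFun (topL b c f) (botL b c f) x ^ 2 = hypFun (topR b c lam) (botR b c lam) x) ∧
    (∀ x u v : ℂ,
      Tendsto (fun n => ∑ k ∈ Finset.range n, hypTerm (topL b c f) (botL b c f) x k)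
        atTop (𝓝 u) →
      Tendsto (fun n => ∑ k ∈ Finset.range n, hypTerm (topR b c lam) (botR b c lam) x k)
        atTop (𝓝 v) →
      u ^ 2 = v) := by
  have hcoeff := sum_antidiagonal_hypCoeff hlam hL hR
  refine ⟨?_, fun x hx => ?_, fun x u v hu hv => sq_eq_of_tendsto_of_coeff hcoeff hu hv⟩
  · ext n
    rw [sq, PowerSeries.coeff_mul]
    simpa only [hypSeries, PowerSeries.coeff_mk] using hcoeff n
  · have hsL := summable_hypTerm (as := topL b c f) (bs := botL b c f) (by simp [topL, botL]) hx
    have hsR := summable_hypTerm (as := topR b c lam) (bs := botR b c lam)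
      (by simp [topR, botR]) hx
    exact ⟨hsL.of_norm, hsR.of_norm, sq_tsum_eq_tsum_of_coeff hcoeff hsL⟩
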